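/- Let $I$ be a linearly ordered set with a topology for which $\le$ is closed in $I\times I$ (for example any subset of $\mathbb R$, such as $\mathbb N\cup\{0\}$, $[0,\infty)$, $\mathbb Z$, $\mathbb R$), and let $X=(X_t)_{t\in I}$ be a real stochastic process on a probability space $(\Omega,\mathcal F,P)$, $\mathcal F_{\le s}=\sigma(X_u:u\le s)$. A *family of polynomial martingales* of $X$ is a family of real polynomials $M_n(\cdot,t)$, $n\ge 0$, $t\in I$, with $M_0=1$ and $\deg M_n(\cdot,t)=n$, such that for each $n$ the process $M_n(t):=M_n(X_t,t)$ is a martingale with respect to $(\mathcal F_{\le s})$, and such that for each $n\ge1$ the function $m_n(t)=\mathbb E M_n(t)^2$ is continuous on $I$ and tends to $0$ at the left-hand end of $I$ (that is, $m_n(l)=0$ if $I$ has a least element $l$, and $m_n(t)\to0$ as $t\to-\infty$ in the order of $I$ otherwise). The process $X$ is a *Markov process with polynomial regression (MPR process)* if it is Markov; for every $t$ the moment generating function of $X_t$ is finite in a neighbourhood of $0$; for all $n\ge 0$ and $s<t$ the conditional moment $\mathbb E(X_t^n\mid\mathcal F_{\le s})$ is a.s. a polynomial of degree $n$ in $X_s$;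 and $X$ has a family of polynomial martingales. The process $X$ has *independent increments* if $X_t-X_s$ is independent of $\mathcal F_{\le s}$ for all $s\le t$. **Proposition.** Let $X$ be an MPR process such that $t\mapsto\mathbb E X_t$ is continuous. Then $X$ has independent increments if and only if there exist a family of polynomial martingales $\{M_n\}$ of $X$ and continuous functions $g_k:I\to\mathbb R$, $k\ge1$, such that for all $n\ge1$ and $t\in I$, almost surely, $$M_n(t)=X_t^n-g_n(t)-\sum_{j=1}^{n-1}\binom nj g_j(t)\,M_{n-j}(t).$$ Moreover, whenever a family of polynomial martingales $\{M_n\}$ and functions $g_k:I\to\mathbb R$ satisfy this recurrence, $g_n(t)=\mathbb E X_t^n$ for all $n\ge1$ and $t\in I$. -/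

import Mathlib

open MeasureTheory ProbabilityTheory Filter Topology

namespace MPR

/-- The natural filtration `F_{≤ s} = σ(X_u : u ≤ s)` of a real-valued process. -/
noncomputable def past {I Ω : Type*} [LinearOrder I] [MeasurableSpace Ω]
    (X : I → Ω → ℝ) (hX : ∀ t, Measurable (X t)) :
    Filtration I (inferInstance : MeasurableSpace Ω) :=
  Filtration.natural X fun t => (hX t).stronglyMeasurable

/-- The Markov property: the conditional law of `X_t` given the whole past up to time `s`
is the conditional law given `X_s`. -/
def IsMarkov {I Ω : Type*} [LinearOrder I] [MeasurableSpace Ω]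
    (P : Measure Ω) (X : I → Ω → ℝ) (hX : ∀ t, Measurable (X t)) : Prop :=
  ∀ s t, s ≤ t → ∀ A : Set ℝ, MeasurableSet A →
    P[(X t ⁻¹' A).indicator (fun _ => (1 : ℝ)) | past X hX s] =ᵐ[P]
      P[(X t ⁻¹' A).indicator (fun _ => (1 : ℝ)) |
        MeasurableSpace.comap (X s) (inferInstance : MeasurableSpace ℝ)]

/-- Polynomial regression: for `s < t`, the conditional moment of degree `n` of `X_t` given the
past up to time `s` is a polynomial of degree `n` in `X_s`. -/
def HasPolynomialRegression {I Ω : Type*} [LinearOrder I] [MeasurableSpace Ω]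
    (P : Measure Ω) (X : I → Ω → ℝ) (hX : ∀ t, Measurable (X t)) : Prop :=
  ∀ (n : ℕ) (s t : I), s < t → ∃ p : Polynomial ℝ, p.natDegree = n ∧
    P[fun ω => X t ω ^ n | past X hX s] =ᵐ[P] fun ω => p.eval (X s ω)

/-- `M n t`, a polynomial of degree `n` in the state variable, is a family of polynomial
martingales of the process `X`, i.e. `M_n(t) = M_n(X_t, t)` is a martingale for every `n`, with
`M_0 = 1`, such that the functions `m_n(t) = E M_n(t)²`, `n ≥ 1`, are continuous and tend to `0` at
the left-hand end of the index set (if `I` has a least element `l`, then `atBot` is the principal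
filter at `l`, and the last condition reads `m_n(l) = 0`). -/
structure IsPolynomialMartingaleFamily {I Ω : Type*} [LinearOrder I] [TopologicalSpace I]
    [MeasurableSpace Ω] (P : Measure Ω) (X : I → Ω → ℝ) (hX : ∀ t, Measurable (X t))
    (M : ℕ → I → Polynomial ℝ) : Prop where
  zero : ∀ t, M 0 t = 1
  natDegree : ∀ n t, (M n t).natDegree = n
  martingale : ∀ n, Martingale (fun t ω => (M n t).eval (X t ω)) (past X hX) P
  continuous_sq : ∀ n, 1 ≤ n → Continuous fun t => ∫ ω, (M n t).eval (X t ω) ^ 2 ∂P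
  tendsto_sq : ∀ n, 1 ≤ n →
    Tendsto (fun t => ∫ ω, (M n t).eval (X t ω) ^ 2 ∂P) atBot (𝓝 0)

/-- A Markov process with polynomial regression (MPR process). -/
structure IsMPR {I Ω : Type*} [LinearOrder I] [TopologicalSpace I]
    [MeasurableSpace Ω] (P : Measure Ω) (X : I → Ω → ℝ) (hX : ∀ t, Measurable (X t)) : Prop where
  markov : IsMarkov P X hX
  /-- The moment generating function of every `X_t` is finite in a neighbourhood of `0`. -/
  mgf : ∀ t, (0 : ℝ) ∈ interior (integrableExpSet (X t) P)
  regression : HasPolynomialRegression P X hX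
  exists_martingales : ∃ M, IsPolynomialMartingaleFamily P X hX M

/-- Independent increments: `X_t - X_s` is independent of `F_{≤ s}` whenever `s ≤ t`. -/
def IncrementsIndepPast {I Ω : Type*} [LinearOrder I] [MeasurableSpace Ω]
    (P : Measure Ω) (X : I → Ω → ℝ) (hX : ∀ t, Measurable (X t)) : Prop :=
  ∀ s t, s ≤ t →
    Indep (MeasurableSpace.comap (fun ω => X t ω - X s ω) (inferInstance : MeasurableSpace ℝ))
      (past X hX s) P

/-- The recurrence
`M_n(t) = X_t^n - g_n(t) - ∑_{j=1}^{n-1} C(n,j) g_j(t) M_{n-j}(t)` for all `n ≥ 1` and all `t`,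
as an identity between random variables. -/
def SatisfiesRecurrence {I Ω : Type*} [MeasurableSpace Ω]
    (P : Measure Ω) (X : I → Ω → ℝ) (M : ℕ → I → Polynomial ℝ) (g : ℕ → I → ℝ) : Prop :=
  ∀ n, 1 ≤ n → ∀ t, ∀ᵐ ω ∂P,
    (M n t).eval (X t ω) = X t ω ^ n - g n t
      - ∑ j ∈ Finset.Ico 1 n, (n.choose j : ℝ) * g j t * (M (n - j) t).eval (X t ω)

end MPR

/-!
# Independent increments and Appell recurrences for polynomial martingales

Write `egf a` for the exponential generating function `∑ aₙ θⁿ / n!` of a sequence, a formal power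
series in `θ`. Products of such series are binomial convolutions of sequences (`egf_binomConv`), and
the recurrence says exactly that `egf g(t) * egf M(t) = egf (X_t ^ ·)`, i.e. that `∑ M_n(t) θⁿ / n!`
is `exp (θ X_t)` divided by the generating function of `1, g₁(t), g₂(t), …`.

A polynomial martingale of positive degree has mean zero, as its second moment tends to `0` at the
left-hand end. Taking expectations in the recurrence gives `gₙ(t) = E X_tⁿ`.

If the recurrence holds, then conditioning `egf (X_t ^ ·) = egf g(t) * egf M(t)` on the past up to
`s` replaces `M(t)` by `M(s)`, so the conditional moments of `X_t - X_s` have the generating function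
`egf g(t) / egf g(s)`, which is deterministic (`SatisfiesRecurrence.condExp_increment_pow`). Since
`X_t - X_s` has exponential moments near `0`, its law on every event of the past is determined by
its moments (`measure_eq_of_moments`), and independence follows.

Conversely, let the increments be independent of the past and let `Y_t = X_t - E X_t`. The Appell
polynomials with generating function `exp (θ Y_t) / E exp (θ Y_t)` are martingales satisfying the
recurrence with `gₙ(t) = E X_tⁿ`. What remains is the regularity of the moments. The linear member of
the given family of polynomial martingales is `a Y_t`, with one `a` for all `t` where `Var Y_t ≠ 0`
(`IncrementsIndepPast.exists_sq_eq_mul_variance`), so the variance is continuous and vanishes at the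
left-hand end; thus `t ↦ Y_t` is continuous in `L²`. Even moments of `Y_t` increase with `t`
(`IncrementsIndepPast.centralMoments_even_mono`), hence are locally bounded, and `L²`-convergence
with bounded moments gives convergence of all moments (`tendsto_integral_pow`). The second moments
of the Appell polynomials are polynomials in these.
-/

namespace MPR

/-! ### Determinacy of laws by their moments -/

/-- Equality of moments propagates from the Taylor coefficients at `0` to a vertical strip on which
both complex moment generating functions are analytic. -/
theorem complexMGF_eqOn_of_moments {μ ν : Measure ℝ} {U : Set ℝ} (hU : IsOpen U)
    (hUc : Convex ℝ U) (h0 : (0 : ℝ) ∈ U) (hμ : U ⊆ integrableExpSet id μ)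
    (hν : U ⊆ integrableExpSet id ν) (h : ∀ n : ℕ, ∫ x, x ^ n ∂μ = ∫ x, x ^ n ∂ν) :
    Set.EqOn (complexMGF id μ) (complexMGF id ν) {z | z.re ∈ U} := by
  have hμ' := interior_maximal hμ hU
  have hν' := interior_maximal hν hU
  have hana : ∀ {κ : Measure ℝ}, U ⊆ interior (integrableExpSet id κ) →
      AnalyticOnNhd ℂ (complexMGF id κ) {z | z.re ∈ U} := fun hκ z hz =>
    analyticAt_complexMGF (hκ hz)
  have hder (n : ℕ) : iteratedDeriv n (complexMGF id μ) 0 = iteratedDeriv n (complexMGF id ν) 0 := by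
    rw [iteratedDeriv_complexMGF (hμ' (by simpa using h0)),
      iteratedDeriv_complexMGF (hν' (by simpa using h0))]
    simpa [← Complex.ofReal_pow, integral_complex_ofReal] using h n
  have hz : (0 : ℂ) ∈ {z : ℂ | z.re ∈ U} := by simpa using h0
  refine (hana hμ').eqOn_of_preconnected_of_eventuallyEq (hana hν') ?_ hz ?_
  · exact (hUc.linear_preimage Complex.reLm).isPreconnected
  · have h1 := (hana hμ' 0 hz).hasFPowerSeriesAt
    have h2 := (hana hν' 0 hz).hasFPowerSeriesAt
    simp only [hder] at h1
    have h3 := h1.sub h2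
    rw [sub_self] at h3
    filter_upwards [h3.eventually_eq_zero] with z hz using sub_eq_zero.1 hz

/-- A finite measure on the line with exponential moments near `0` is determined by its moments:
the complex moment generating functions are analytic in a vertical strip, have the same Taylor
coefficients at `0`, and therefore agree on the imaginary axis, where they are the characteristic
functions. -/
theorem measure_eq_of_moments {μ ν : Measure ℝ} [IsFiniteMeasure μ] [IsFiniteMeasure ν]
    (hμ : (0 : ℝ) ∈ interior (integrableExpSet id μ))
    (hν : (0 : ℝ) ∈ interior (integrableExpSet id ν))
    (h : ∀ n : ℕ, ∫ x, x ^ n ∂μ = ∫ x, x ^ n ∂ν) : μ = ν := by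
  have hEq := complexMGF_eqOn_of_moments (isOpen_interior.inter isOpen_interior)
    (convex_integrableExpSet.interior.inter convex_integrableExpSet.interior) ⟨hμ, hν⟩
    (Set.inter_subset_left.trans interior_subset) (Set.inter_subset_right.trans interior_subset) h
  refine Measure.ext_of_charFun (funext fun t => ?_)
  rw [← complexMGF_id_mul_I, ← complexMGF_id_mul_I]
  exact hEq (by simpa using ⟨hμ, hν⟩)

theorem zero_mem_interior_integrableExpSet_sub {Ω : Type*} [MeasurableSpace Ω] {P : Measure Ω}
    {X Y : Ω → ℝ} (hX : Measurable X) (hY : Measurable Y)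
    (h1 : (0 : ℝ) ∈ interior (integrableExpSet X P))
    (h2 : (0 : ℝ) ∈ interior (integrableExpSet Y P)) :
    (0 : ℝ) ∈ interior (integrableExpSet (fun ω => X ω - Y ω) P) := by
  rw [mem_interior_iff_mem_nhds] at *
  have e1 : ∀ᶠ θ : ℝ in 𝓝 0, 2 * θ ∈ integrableExpSet X P :=
    (by fun_prop : Continuous fun θ : ℝ => 2 * θ).continuousAt.eventually (by simpa using h1)
  have e2 : ∀ᶠ θ : ℝ in 𝓝 0, -2 * θ ∈ integrableExpSet Y P :=
    (by fun_prop : Continuous fun θ : ℝ => -2 * θ).continuousAt.eventually (by simpa using h2)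
  filter_upwards [e1, e2] with θ i1 i2
  simp only [integrableExpSet, Set.mem_ofPred_eq] at i1 i2 ⊢
  refine (i1.add i2).mono' (by fun_prop) (.of_forall fun ω => ?_)
  have h3 := sq_nonneg (Real.exp (θ * X ω) - Real.exp (-θ * Y ω))
  have a1 : Real.exp (2 * θ * X ω) = Real.exp (θ * X ω) ^ 2 := by
    rw [← Real.exp_nat_mul]; congr 1; push_cast; ring
  have a2 : Real.exp (-2 * θ * Y ω) = Real.exp (-θ * Y ω) ^ 2 := by
    rw [← Real.exp_nat_mul]; congr 1; push_cast; ring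
  have a3 : Real.exp (θ * (X ω - Y ω)) = Real.exp (θ * X ω) * Real.exp (-θ * Y ω) := by
    rw [← Real.exp_add]; congr 1; ring
  rw [Real.norm_of_nonneg (Real.exp_pos _).le, Pi.add_apply, a1, a2, a3]
  nlinarith [Real.exp_pos (θ * X ω), Real.exp_pos (-θ * Y ω),
    mul_pos (Real.exp_pos (θ * X ω)) (Real.exp_pos (-θ * Y ω))]

/-- If all moments of `D` over every event of `m` factor as on an independent event, and `D` has
exponential moments near `0`, then `D` is independent of `m`. -/
theorem indep_of_setIntegral_pow {Ω : Type*} {m m0 : MeasurableSpace Ω} {P : Measure Ω}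
    [IsProbabilityMeasure P] {D : Ω → ℝ} (hD : Measurable D)
    (hexp : (0 : ℝ) ∈ interior (integrableExpSet D P))
    (h : ∀ (n : ℕ) (A : Set Ω), MeasurableSet[m] A →
      ∫ ω in A, D ω ^ n ∂P = P.real A * ∫ ω, D ω ^ n ∂P) :
    Indep (MeasurableSpace.comap D inferInstance) m P := by
  rw [Indep_iff]
  rintro _ A ⟨B, hB, rfl⟩ hA
  have hexp' : (0 : ℝ) ∈ interior (integrableExpSet id (P.map D)) := by
    convert hexp using 2
    ext θ
    simp only [integrableExpSet, Set.mem_ofPred_eq]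
    rw [integrable_map_measure (by fun_prop) (by fun_prop)]
    rfl
  have key : (P.restrict A).map D = P A • P.map D := by
    have : IsFiniteMeasure (P A • P.map D) := Measure.smul_finite _ (measure_ne_top _ _)
    refine measure_eq_of_moments (interior_mono ?_ hexp') (interior_mono ?_ hexp') fun n => ?_
    · exact fun θ hθ => hθ.mono_measure (Measure.map_mono Measure.restrict_le_self hD)
    · exact fun θ hθ => hθ.smul_measure (measure_ne_top _ _)
    · rw [integral_smul_measure, integral_map (by fun_prop) (by fun_prop),
        integral_map (by fun_prop) (by fun_prop), h n A hA]
      rfl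
  have := congrArg (fun μ => μ B) key
  simp only [Measure.smul_apply, smul_eq_mul, Measure.map_apply hD hB,
    Measure.restrict_apply (hD hB)] at this
  rw [this, mul_comm]

/-! ### Exponential generating functions -/

/-- The exponential generating function `∑ aₙ θⁿ / n!` of a real sequence. -/
noncomputable def egf (a : ℕ → ℝ) : PowerSeries ℝ := PowerSeries.mk fun n => a n / n.factorial

/-- The binomial convolution `n ↦ ∑_{i+j=n} C(n,i) aᵢ bⱼ` of two sequences. -/
def binomConv (a b : ℕ → ℝ) (n : ℕ) : ℝ :=
  ∑ p ∈ Finset.HasAntidiagonal.antidiagonal n, (n.choose p.1 : ℝ) * (a p.1 * b p.2)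

theorem egf_injective : Function.Injective egf := fun a b h => funext fun n => by
  have := congrArg (PowerSeries.coeff n) h
  simpa [egf, div_left_inj' (Nat.cast_ne_zero.2 n.factorial_ne_zero : (n.factorial : ℝ) ≠ 0)]
    using this

theorem egf_binomConv (a b : ℕ → ℝ) : egf (binomConv a b) = egf a * egf b := by
  ext n
  simp only [egf, PowerSeries.coeff_mk, PowerSeries.coeff_mul, binomConv, Finset.sum_div]
  refine Finset.sum_congr rfl fun p hp => ?_
  obtain rfl := Finset.HasAntidiagonal.mem_antidiagonal.1 hp
  rw [Nat.cast_add_choose]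
  have := Nat.factorial_ne_zero p.1
  have := Nat.factorial_ne_zero p.2
  have := Nat.factorial_ne_zero (p.1 + p.2)
  field_simp

theorem binomConv_pow (x y : ℝ) : binomConv (x ^ ·) (y ^ ·) = ((x + y) ^ ·) := by
  funext n
  simp only [binomConv, (Commute.all x y).add_pow', nsmul_eq_mul]

theorem egf_pow_mul (x y : ℝ) : egf (x ^ ·) * egf (y ^ ·) = egf ((x + y) ^ ·) := by
  rw [← egf_binomConv, binomConv_pow]

theorem egf_zero_pow : egf ((0 : ℝ) ^ ·) = 1 := by
  ext n
  rcases n with _ | n <;> simp [egf, PowerSeries.coeff_one]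

theorem constantCoeff_egf (a : ℕ → ℝ) : PowerSeries.constantCoeff (egf a) = a 0 := by
  rw [← PowerSeries.coeff_zero_eq_constantCoeff_apply]
  simp only [egf, PowerSeries.coeff_mk, Nat.factorial_zero, Nat.cast_one, div_one]

/-- The end terms of a binomial convolution of sequences starting with `1`. -/
theorem binomConv_eq_of_one {a b : ℕ → ℝ} (ha : a 0 = 1) (hb : b 0 = 1) {n : ℕ} (hn : 1 ≤ n) :
    binomConv a b n = b n + a n + ∑ j ∈ Finset.Ico 1 n, (n.choose j : ℝ) * a j * b (n - j) := by
  rw [binomConv, Finset.Nat.sum_antidiagonal_eq_sum_range_succ_mk, Finset.sum_range_succ,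
    Finset.range_eq_Ico, Finset.sum_eq_sum_Ico_succ_bot (by omega)]
  simp [ha, hb, mul_assoc]
  ring

/-- The sequence `h` with `egf h = (egf g)⁻¹`. -/
noncomputable def egfInv (g : ℕ → ℝ) (n : ℕ) : ℝ :=
  n.factorial * PowerSeries.coeff n (egf g)⁻¹

theorem egf_egfInv (g : ℕ → ℝ) : egf (egfInv g) = (egf g)⁻¹ := by
  ext n
  simp [egf, egfInv, mul_div_cancel_left₀ _
    (Nat.cast_ne_zero.2 n.factorial_ne_zero : (n.factorial : ℝ) ≠ 0)]

theorem egf_mul_inv {g : ℕ → ℝ} (hg : g 0 = 1) : egf g * (egf g)⁻¹ = 1 :=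
  PowerSeries.mul_inv_cancel _ (by simp [constantCoeff_egf, hg])

theorem egfInv_zero {g : ℕ → ℝ} (hg : g 0 = 1) : egfInv g 0 = 1 := by
  simp [egfInv, constantCoeff_egf, hg]

theorem egfInv_eq {g : ℕ → ℝ} (hg : g 0 = 1) {n : ℕ} (hn : 1 ≤ n) :
    egfInv g n = - g n - ∑ j ∈ Finset.Ico 1 n, (n.choose j : ℝ) * g j * egfInv g (n - j) := by
  have h : binomConv g (egfInv g) = ((0 : ℝ) ^ ·) := egf_injective <| by
    rw [egf_binomConv, egf_egfInv, egf_mul_inv hg, egf_zero_pow]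
  have h2 := congrFun h n
  simp only [binomConv_eq_of_one hg (egfInv_zero hg) hn] at h2
  rw [zero_pow (by omega)] at h2
  linarith

/-- Each term of `egfInv g` is a polynomial in the terms of `g`, hence depends continuously on
them. -/
theorem tendsto_egfInv {ι : Type*} {l : Filter ι} {g : ι → ℕ → ℝ} {g₀ : ℕ → ℝ}
    (hg : ∀ t, g t 0 = 1) (hg₀ : g₀ 0 = 1) (h : ∀ n, Tendsto (fun t => g t n) l (𝓝 (g₀ n)))
    (n : ℕ) : Tendsto (fun t => egfInv (g t) n) l (𝓝 (egfInv g₀ n)) := by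
  induction n using Nat.strong_induction_on with
  | _ n ih =>
    rcases Nat.eq_zero_or_pos n with rfl | hn
    · simp only [egfInv_zero (hg _), egfInv_zero hg₀, tendsto_const_nhds]
    · simp only [egfInv_eq (hg _) hn, egfInv_eq hg₀ hn]
      refine (h n).neg.sub (tendsto_finsetSum _ fun j hj => ?_)
      have := Finset.mem_Ico.1 hj
      exact ((h j).const_mul _).mul (ih _ (by omega))

/-! ### Random variables with all moments -/

/-- `f` has finite absolute moments of all orders. -/
def HasMoments {Ω : Type*} [MeasurableSpace Ω] (f : Ω → ℝ) (P : Measure Ω) : Prop :=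
  ∀ p : ℕ, MemLp f p P

namespace HasMoments

variable {Ω : Type*} [MeasurableSpace Ω] {P : Measure Ω} {f g : Ω → ℝ}

theorem integrable (hf : HasMoments f P) : Integrable f P :=
  memLp_one_iff_integrable.1 (by simpa using hf 1)

theorem add (hf : HasMoments f P) (hg : HasMoments g P) : HasMoments (fun ω => f ω + g ω) P :=
  fun p => (hf p).add (hg p)

theorem sub (hf : HasMoments f P) (hg : HasMoments g P) : HasMoments (fun ω => f ω - g ω) P :=
  fun p => (hf p).sub (hg p)

theorem neg (hf : HasMoments f P) : HasMoments (fun ω => - f ω) P :=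
  fun p => (hf p).neg

theorem mul (hf : HasMoments f P) (hg : HasMoments g P) : HasMoments (fun ω => f ω * g ω) P := by
  intro p
  have : ENNReal.HolderTriple ((2 * p : ℕ) : ENNReal) ((2 * p : ℕ) : ENNReal) (p : ENNReal) := by
    constructor
    push_cast
    rw [ENNReal.mul_inv (by simp) (by simp), ← add_mul, ENNReal.inv_two_add_inv_two, one_mul]
  exact (hg (2 * p)).mul' (hf (2 * p))

theorem const [IsFiniteMeasure P] (c : ℝ) : HasMoments (fun _ : Ω => c) P :=
  fun _ => memLp_const c

theorem pow [IsFiniteMeasure P] (hf : HasMoments f P) (n : ℕ) :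
    HasMoments (fun ω => f ω ^ n) P := by
  induction n with
  | zero => simpa using const 1
  | succ n ih => simpa only [pow_succ] using ih.mul hf

theorem sum [IsFiniteMeasure P] {ι : Type*} {s : Finset ι} {F : ι → Ω → ℝ}
    (hF : ∀ i ∈ s, HasMoments (F i) P) : HasMoments (fun ω => ∑ i ∈ s, F i ω) P :=
  fun p => memLp_finsetSum s fun i hi => hF i hi p

theorem polynomial_eval [IsFiniteMeasure P] (hf : HasMoments f P) (p : Polynomial ℝ) :
    HasMoments (fun ω => p.eval (f ω)) P := by
  simp only [Polynomial.eval_eq_sum_range]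
  exact sum fun i _ => (const _).mul (hf.pow i)

end HasMoments

/-- The Cauchy–Schwarz inequality. -/
theorem sq_integral_mul_le {Ω : Type*} [MeasurableSpace Ω] {P : Measure Ω} {f g : Ω → ℝ}
    (hf : HasMoments f P) (hg : HasMoments g P) :
    (∫ ω, f ω * g ω ∂P) ^ 2 ≤ (∫ ω, f ω ^ 2 ∂P) * ∫ ω, g ω ^ 2 ∂P := by
  have h1 : Integrable (fun ω => f ω ^ 2) P := by simpa only [sq] using (hf.mul hf).integrable
  have h2 : Integrable (fun ω => g ω ^ 2) P := by simpa only [sq] using (hg.mul hg).integrable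
  have h3 := (hf.mul hg).integrable
  have key (c : ℝ) : 0 ≤ (∫ ω, g ω ^ 2 ∂P) * (c * c) + (2 * ∫ ω, f ω * g ω ∂P) * c
      + ∫ ω, f ω ^ 2 ∂P := by
    have : ∫ ω, (f ω + c * g ω) ^ 2 ∂P = (∫ ω, g ω ^ 2 ∂P) * (c * c)
        + (2 * ∫ ω, f ω * g ω ∂P) * c + ∫ ω, f ω ^ 2 ∂P := by
      have e : ∀ ω, (f ω + c * g ω) ^ 2 = (c * c) * g ω ^ 2 + (2 * c) * (f ω * g ω) + f ω ^ 2 :=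
        fun ω => by ring
      simp only [e]
      rw [integral_add (by exact (h2.const_mul _).add (h3.const_mul _)) h1,
        integral_add (h2.const_mul _) (h3.const_mul _), integral_const_mul, integral_const_mul]
      ring
    rw [← this]
    exact integral_nonneg fun ω => sq_nonneg _
  have := discrim_le_zero key
  rw [discrim] at this
  nlinarith

/-- A bound for the square of `(xⁿ - yⁿ) / (x - y)` by even powers. -/
theorem sq_geom_sum₂_le (x y : ℝ) (n : ℕ) :
    (∑ i ∈ Finset.range n, x ^ i * y ^ (n - 1 - i)) ^ 2 ≤
      (n : ℝ) * (n * (x ^ (2 * (n - 1)) + y ^ (2 * (n - 1)))) := by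
  refine (sq_sum_le_card_mul_sum_sq).trans ?_
  rw [Finset.card_range]
  refine mul_le_mul_of_nonneg_left ?_ (by positivity)
  have : ∀ i ∈ Finset.range n, (x ^ i * y ^ (n - 1 - i)) ^ 2 ≤
      x ^ (2 * (n - 1)) + y ^ (2 * (n - 1)) := by
    intro i hi
    have hi := Finset.mem_range.1 hi
    obtain ⟨j, hj⟩ : ∃ j, n - 1 = i + j := ⟨n - 1 - i, by omega⟩
    have hx := sq_nonneg x
    have hy := sq_nonneg y
    rw [hj, Nat.add_sub_cancel_left, mul_pow, ← pow_mul, ← pow_mul, mul_comm i, mul_comm j, pow_mul,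
      pow_mul, pow_mul x, pow_mul y]
    rcases le_total (x ^ 2) (y ^ 2) with h | h
    · calc (x ^ 2) ^ i * (y ^ 2) ^ j ≤ (y ^ 2) ^ i * (y ^ 2) ^ j := by gcongr
        _ = (y ^ 2) ^ (i + j) := (pow_add _ _ _).symm
        _ ≤ _ := le_add_of_nonneg_left (by positivity)
    · calc (x ^ 2) ^ i * (y ^ 2) ^ j ≤ (x ^ 2) ^ i * (x ^ 2) ^ j := by gcongr
        _ = (x ^ 2) ^ (i + j) := (pow_add _ _ _).symm
        _ ≤ _ := le_add_of_nonneg_right (by positivity)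
  simpa [mul_add] using Finset.sum_le_sum this

/-- Convergence in `L²` together with boundedness of all even moments implies convergence of all
moments. -/
theorem tendsto_integral_pow {Ω ι : Type*} [MeasurableSpace Ω] {P : Measure Ω} [IsFiniteMeasure P]
    {l : Filter ι} {Y : ι → Ω → ℝ} {Z : Ω → ℝ} (hY : ∀ i, HasMoments (Y i) P)
    (hZ : HasMoments Z P) (hb : ∀ k : ℕ, ∃ C, ∀ᶠ i in l, ∫ ω, Y i ω ^ (2 * k) ∂P ≤ C)
    (h2 : Tendsto (fun i => ∫ ω, (Y i ω - Z ω) ^ 2 ∂P) l (𝓝 0)) (n : ℕ) :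
    Tendsto (fun i => ∫ ω, Y i ω ^ n ∂P) l (𝓝 (∫ ω, Z ω ^ n ∂P)) := by
  obtain ⟨C, hC⟩ := hb (n - 1)
  rw [tendsto_iff_norm_sub_tendsto_zero]
  set K : ℝ := (n : ℝ) * (n * (C + ∫ ω, Z ω ^ (2 * (n - 1)) ∂P))
  have hlim : Tendsto (fun i => √((∫ ω, (Y i ω - Z ω) ^ 2 ∂P) * K)) l (𝓝 0) := by
    simpa [Function.comp_def] using (Real.continuous_sqrt.tendsto _).comp (h2.mul_const K)
  refine squeeze_zero' (.of_forall fun i => norm_nonneg _) ?_ hlim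
  filter_upwards [hC] with i hi
  refine Real.abs_le_sqrt ?_
  let Q : Ω → ℝ := fun ω => ∑ j ∈ Finset.range n, Y i ω ^ j * Z ω ^ (n - 1 - j)
  have hQ : HasMoments Q P := HasMoments.sum fun j _ => ((hY i).pow j).mul (hZ.pow _)
  have e1 : ∫ ω, Y i ω ^ n ∂P - ∫ ω, Z ω ^ n ∂P = ∫ ω, (Y i ω - Z ω) * Q ω ∂P := by
    rw [← integral_sub ((hY i).pow n).integrable (hZ.pow n).integrable]
    refine integral_congr_ae (.of_forall fun ω => ?_)
    simp only [Q, mul_comm (Y i ω - Z ω), geom_sum₂_mul]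
  rw [e1]
  refine (sq_integral_mul_le ((hY i).sub hZ) hQ).trans ?_
  refine mul_le_mul_of_nonneg_left ?_ (integral_nonneg fun ω => sq_nonneg _)
  calc ∫ ω, Q ω ^ 2 ∂P ≤ ∫ ω, (n : ℝ) * (n * (Y i ω ^ (2 * (n - 1)) + Z ω ^ (2 * (n - 1)))) ∂P :=
        integral_mono (hQ.pow 2).integrable
          ((((hY i).pow _).add (hZ.pow _)).integrable.const_mul _ |>.const_mul _)
          fun ω => sq_geom_sum₂_le _ _ _
    _ = (n : ℝ) * (n * (∫ ω, Y i ω ^ (2 * (n - 1)) ∂P + ∫ ω, Z ω ^ (2 * (n - 1)) ∂P)) := by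
        rw [integral_const_mul, integral_const_mul,
          integral_add ((hY i).pow _).integrable (hZ.pow _).integrable]
    _ ≤ (n : ℝ) * (n * (C + ∫ ω, Z ω ^ (2 * (n - 1)) ∂P)) := by gcongr

/-! ### Conditional moments -/

section CondExp

variable {Ω : Type*} {m m0 : MeasurableSpace Ω} {P : Measure Ω}

/-- A binomial convolution with measurable first sequence is conditioned by conditioning the second
sequence. -/
theorem condExp_binomConv {U V : ℕ → Ω → ℝ}
    (hUm : ∀ i, StronglyMeasurable[m] (U i))
    (hU : ∀ i, HasMoments (U i) P) (hV : ∀ i, HasMoments (V i) P) (n : ℕ) :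
    P[fun ω => binomConv (U · ω) (V · ω) n | m] =ᵐ[P]
      fun ω => binomConv (U · ω) (fun j => P[V j | m] ω) n := by
  have e : (fun ω => binomConv (U · ω) (V · ω) n) =
      ∑ p ∈ Finset.HasAntidiagonal.antidiagonal n, ((n.choose p.1 : ℝ) • (U p.1 * V p.2)) := by
    funext ω
    simp [binomConv, Finset.sum_apply]
  rw [e]
  refine (condExp_finsetSum (fun p _ => ((hU p.1).mul (hV p.2)).integrable.smul _) m).trans ?_
  have key : ∀ p : ℕ × ℕ, P[(n.choose p.1 : ℝ) • (U p.1 * V p.2) | m] =ᵐ[P]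
      fun ω => (n.choose p.1 : ℝ) * (U p.1 ω * P[V p.2 | m] ω) := fun p => by
    filter_upwards [condExp_smul (μ := P) (n.choose p.1 : ℝ) (U p.1 * V p.2) m,
      condExp_mul_of_stronglyMeasurable_left (hUm p.1) ((hU p.1).mul (hV p.2)).integrable
        (hV p.2).integrable] with ω h1 h2
    rw [h1, Pi.smul_apply, h2, smul_eq_mul, Pi.mul_apply]
  filter_upwards [ae_all_iff.2 key] with ω h
  rw [Finset.sum_apply]
  exact Finset.sum_congr rfl fun p _ => h p

theorem integral_binomConv {a : ℕ → ℝ} {V : ℕ → Ω → ℝ} (hV : ∀ i, HasMoments (V i) P) (n : ℕ) :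
    ∫ ω, binomConv a (V · ω) n ∂P = binomConv a (fun j => ∫ ω, V j ω ∂P) n := by
  simp only [binomConv]
  rw [integral_finsetSum _ fun p _ => ((hV p.2).integrable.const_mul _).const_mul _]
  simp only [integral_const_mul]

end CondExp

/-! ### From the recurrence to independent increments -/

theorem IsMPR.hasMoments {I Ω : Type*} [LinearOrder I] [TopologicalSpace I] [MeasurableSpace Ω]
    {P : Measure Ω} {X : I → Ω → ℝ} {hX : ∀ t, Measurable (X t)} (h : IsMPR P X hX) (t : I) :
    HasMoments (X t) P :=
  fun p => by exact_mod_cast memLp_of_mem_interior_integrableExpSet (h.mgf t) p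

theorem stronglyMeasurable_past {I Ω : Type*} [LinearOrder I] [MeasurableSpace Ω]
    (X : I → Ω → ℝ) (hX : ∀ t, Measurable (X t)) (s : I) : StronglyMeasurable[past X hX s] (X s) :=
  Filtration.stronglyAdapted_natural (fun t => (hX t).stronglyMeasurable) s

section

variable {I Ω : Type*} [LinearOrder I] [TopologicalSpace I] [MeasurableSpace Ω]
  {P : Measure Ω} {X : I → Ω → ℝ} {hX : ∀ t, Measurable (X t)}
  {M : ℕ → I → Polynomial ℝ}

/-- The sequence `1, g₁(t), g₂(t), …`. -/
def withOne (g : ℕ → I → ℝ) (t : I) (n : ℕ) : ℝ := if n = 0 then 1 else g n t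

/-- The recurrence says that, as formal power series in `θ`, the exponential generating function of
the martingales is `exp (θ X_t)` divided by the exponential generating function of the `gₙ(t)`. -/
theorem SatisfiesRecurrence.binomConv_eq (hM : IsPolynomialMartingaleFamily P X hX M)
    {g : ℕ → I → ℝ} (hg : SatisfiesRecurrence P X M g) (t : I) :
    ∀ᵐ ω ∂P, binomConv (withOne g t) (fun n => (M n t).eval (X t ω)) = (X t ω ^ ·) := by
  have h := ae_all_iff.2 fun n : ℕ => ae_all_iff.2 fun hn : 1 ≤ n => hg n hn t
  filter_upwards [h] with ω hω
  funext n
  rcases Nat.eq_zero_or_pos n with rfl | hn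
  · simp [binomConv, withOne, hM.zero]
  · rw [binomConv_eq_of_one (by simp [withOne]) (by simp [hM.zero]) hn, hω n hn]
    have : ∑ j ∈ Finset.Ico 1 n, (n.choose j : ℝ) * withOne g t j * (M (n - j) t).eval (X t ω) =
        ∑ j ∈ Finset.Ico 1 n, (n.choose j : ℝ) * g j t * (M (n - j) t).eval (X t ω) :=
      Finset.sum_congr rfl fun j hj => by
        have := Finset.mem_Ico.1 hj
        rw [withOne, if_neg (by omega)]
    rw [this, withOne, if_neg (by omega)]
    ring

variable [IsProbabilityMeasure P]

/-- The mean of a martingale is constant in time, and it is at most the root mean square, which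
tends to `0` at the left-hand end. -/
theorem IsPolynomialMartingaleFamily.integral_eq_zero (hM : IsPolynomialMartingaleFamily P X hX M)
    (hmom : ∀ t, HasMoments (X t) P) {n : ℕ} (hn : 1 ≤ n) (t : I) :
    ∫ ω, (M n t).eval (X t ω) ∂P = 0 := by
  have : Nonempty I := ⟨t⟩
  have hmean (s : I) (hs : s ≤ t) :
      ∫ ω, (M n s).eval (X s ω) ∂P = ∫ ω, (M n t).eval (X t ω) ∂P := by
    rw [← integral_condExp ((past X hX).le s) (f := fun ω => (M n t).eval (X t ω))]
    exact integral_congr_ae ((hM.martingale n).2 s t hs).symm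
  have hle : (∫ ω, (M n t).eval (X t ω) ∂P) ^ 2 ≤ 0 := by
    refine ge_of_tendsto (hM.tendsto_sq n hn) ?_
    filter_upwards [eventually_le_atBot t] with s hs
    rw [← hmean s hs]
    simpa using sq_integral_mul_le ((hmom s).polynomial_eval (M n s))
      (HasMoments.const (P := P) 1)
  exact pow_eq_zero_iff two_ne_zero |>.1 (le_antisymm hle (sq_nonneg _))

theorem SatisfiesRecurrence.eq_integral_pow (hM : IsPolynomialMartingaleFamily P X hX M)
    (hmom : ∀ t, HasMoments (X t) P) {g : ℕ → I → ℝ} (hg : SatisfiesRecurrence P X M g) {n : ℕ}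
    (hn : 1 ≤ n) (t : I) : g n t = ∫ ω, X t ω ^ n ∂P := by
  have hint (k : ℕ) : Integrable (fun ω => (M k t).eval (X t ω)) P :=
    ((hmom t).polynomial_eval _).integrable
  have hsum : ∀ j ∈ Finset.Ico 1 n, Integrable
      (fun ω => (n.choose j : ℝ) * g j t * (M (n - j) t).eval (X t ω)) P :=
    fun j _ => (hint _).const_mul _
  have h := integral_congr_ae (hg n hn t)
  rw [hM.integral_eq_zero hmom hn, integral_sub
      (by exact ((hmom t).pow n).integrable.sub (integrable_const _)) (integrable_finsetSum _ hsum),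
    integral_sub ((hmom t).pow n).integrable (integrable_const _), integral_finsetSum _ hsum,
    Finset.sum_eq_zero (fun j hj => ?_)] at h
  · simp only [integral_const, probReal_univ, one_smul, sub_zero] at h
    linarith
  · have := Finset.mem_Ico.1 hj
    rw [integral_const_mul, hM.integral_eq_zero hmom (by omega), mul_zero]

/-- Under the recurrence the conditional moments of an increment are deterministic: their
exponential generating function is the quotient of those of `g(t)` and `g(s)`. -/
theorem SatisfiesRecurrence.condExp_increment_pow (hM : IsPolynomialMartingaleFamily P X hX M)
    (hmom : ∀ t, HasMoments (X t) P) {g : ℕ → I → ℝ} (hg : SatisfiesRecurrence P X M g) {s t : I}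
    (hst : s ≤ t) (n : ℕ) :
    P[fun ω => (X t ω - X s ω) ^ n | past X hX s] =ᵐ[P]
      fun _ => binomConv (withOne g t) (egfInv (withOne g s)) n := by
  have hmomM (n : ℕ) : HasMoments (fun ω => (M n t).eval (X t ω)) P := (hmom t).polynomial_eval _
  have hpow (n : ℕ) : P[fun ω => X t ω ^ n | past X hX s] =ᵐ[P]
      fun ω => binomConv (withOne g t) (fun j => (M j s).eval (X s ω)) n := by
    have h1 : (fun ω => X t ω ^ n) =ᵐ[P]
        fun ω => binomConv (withOne g t) (fun j => (M j t).eval (X t ω)) n := by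
      filter_upwards [hg.binomConv_eq hM t] with ω hω using (congrFun hω n).symm
    refine (condExp_congr_ae h1).trans ((condExp_binomConv
      (U := fun i _ => withOne g t i) (fun _ => stronglyMeasurable_const)
      (fun _ => HasMoments.const _) hmomM n).trans ?_)
    filter_upwards [ae_all_iff.2 fun j => (hM.martingale j).2 s t hst] with ω hω
    simp only [hω]
  have hinc : (fun ω => (X t ω - X s ω) ^ n) =
      fun ω => binomConv ((- X s ω) ^ ·) (X t ω ^ ·) n := by
    funext ω
    rw [binomConv_pow, neg_add_eq_sub]
  rw [hinc]
  refine (condExp_binomConv (fun i => (stronglyMeasurable_past X hX s).neg.pow i)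
    (fun i => (hmom s).neg.pow i) (fun i => (hmom t).pow i) n).trans ?_
  filter_upwards [ae_all_iff.2 hpow, hg.binomConv_eq hM s] with ω h1 h2
  refine congrFun (egf_injective ?_) n
  simp only [h1, egf_binomConv, egf_egfInv]
  have h3 := congrArg egf h2
  rw [egf_binomConv] at h3
  have hinv : egf (withOne g s) * (egf (withOne g s))⁻¹ = 1 := egf_mul_inv (by simp [withOne])
  have hexp : egf ((- X s ω) ^ ·) * egf (X s ω ^ ·) = 1 := by
    rw [egf_pow_mul, neg_add_cancel, egf_zero_pow]
  linear_combination (egf (withOne g t) * (egf (withOne g s))⁻¹) * (hexp +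
    egf ((- X s ω) ^ ·) * h3) -
    egf ((- X s ω) ^ ·) * egf (withOne g t) * egf (fun n => (M n s).eval (X s ω)) * hinv

theorem SatisfiesRecurrence.incrementsIndepPast (hMPR : IsMPR P X hX)
    (hM : IsPolynomialMartingaleFamily P X hX M) {g : ℕ → I → ℝ}
    (hg : SatisfiesRecurrence P X M g) : IncrementsIndepPast P X hX := by
  intro s t hst
  have hmom := hMPR.hasMoments
  refine indep_of_setIntegral_pow ((hX t).sub (hX s))
    (zero_mem_interior_integrableExpSet_sub (hX t) (hX s) (hMPR.mgf t) (hMPR.mgf s))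
    fun n A hA => ?_
  have key (B : Set Ω) (hB : MeasurableSet[past X hX s] B) :
      ∫ ω in B, (X t ω - X s ω) ^ n ∂P =
        P.real B * binomConv (withOne g t) (egfInv (withOne g s)) n := by
    rw [← setIntegral_condExp ((past X hX).le s) (((hmom t).sub (hmom s)).pow n).integrable hB,
      setIntegral_congr_ae ((past X hX).le s _ hB)
        ((hg.condExp_increment_pow hM hmom hst n).mono fun ω h _ => h), setIntegral_const,
      smul_eq_mul]
  have huniv := key Set.univ MeasurableSet.univ
  rw [setIntegral_univ, probReal_univ, one_mul] at huniv
  exact (key A hA).trans (by rw [huniv])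

end

/-! ### The centered process and its moments -/

section Centered

variable {I Ω : Type*} [MeasurableSpace Ω]

/-- The centered process `Y_t = X_t - E X_t`. -/
noncomputable def centered (P : Measure Ω) (X : I → Ω → ℝ) (t : I) (ω : Ω) : ℝ :=
  X t ω - ∫ ω', X t ω' ∂P

/-- The central moments `E (X_t - E X_t)ⁿ`. -/
noncomputable def centralMoments (P : Measure Ω) (X : I → Ω → ℝ) (t : I) (n : ℕ) : ℝ :=
  ∫ ω, centered P X t ω ^ n ∂P

/-- The moments of the increments of the centered process. -/
noncomputable def incrementMoments (P : Measure Ω) (X : I → Ω → ℝ) (s t : I) (n : ℕ) : ℝ :=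
  ∫ ω, (centered P X t ω - centered P X s ω) ^ n ∂P

variable {P : Measure Ω} {X : I → Ω → ℝ}

theorem stronglyMeasurable_centered [LinearOrder I] (hX : ∀ t, Measurable (X t)) (s : I) :
    StronglyMeasurable[past X hX s] (centered P X s) :=
  (stronglyMeasurable_past X hX s).sub stronglyMeasurable_const

variable [IsProbabilityMeasure P]

theorem hasMoments_centered (hmom : ∀ t, HasMoments (X t) P) (t : I) :
    HasMoments (centered P X t) P :=
  (hmom t).sub (HasMoments.const _)

theorem integral_centered (hmom : ∀ t, HasMoments (X t) P) (t : I) :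
    ∫ ω, centered P X t ω ∂P = 0 := by
  simp only [centered]
  rw [integral_sub (hmom t).integrable (integrable_const _)]
  simp

theorem centralMoments_zero (t : I) : centralMoments P X t 0 = 1 := by
  simp [centralMoments]

theorem centralMoments_one (hmom : ∀ t, HasMoments (X t) P) (t : I) :
    centralMoments P X t 1 = 0 := by
  simpa [centralMoments] using integral_centered hmom t

theorem incrementMoments_zero (s t : I) : incrementMoments P X s t 0 = 1 := by
  simp [incrementMoments]

theorem incrementMoments_one (hmom : ∀ t, HasMoments (X t) P) (s t : I) :
    incrementMoments P X s t 1 = 0 := by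
  simp only [incrementMoments, pow_one]
  rw [integral_sub (hasMoments_centered hmom t).integrable (hasMoments_centered hmom s).integrable,
    integral_centered hmom, integral_centered hmom, sub_zero]

theorem integral_pow_eq_binomConv (hmom : ∀ t, HasMoments (X t) P) (t : I) (n : ℕ) :
    ∫ ω, X t ω ^ n ∂P = binomConv ((∫ ω, X t ω ∂P) ^ ·) (centralMoments P X t) n := by
  refine Eq.trans ?_ (integral_binomConv (fun i => (hasMoments_centered hmom t).pow i) n)
  simp only [binomConv_pow, centered, add_sub_cancel]

variable [LinearOrder I] {hX : ∀ t, Measurable (X t)}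

namespace IncrementsIndepPast

theorem condExp_increment_pow (h : IncrementsIndepPast P X hX) {s t : I} (hst : s ≤ t) (n : ℕ) :
    P[fun ω => (centered P X t ω - centered P X s ω) ^ n | past X hX s] =ᵐ[P]
      fun _ => incrementMoments P X s t n := by
  refine condExp_indep_eq (Measurable.comap_le ((hX t).sub (hX s))) ((past X hX).le s) ?_ (h s t hst)
  have hm : Measurable[MeasurableSpace.comap (fun ω => X t ω - X s ω) inferInstance]
      (fun ω => X t ω - X s ω) := comap_measurable _
  have e : (fun ω => (centered P X t ω - centered P X s ω) ^ n) = fun ω =>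
      ((X t ω - X s ω) + (∫ ω', X s ω' ∂P - ∫ ω', X t ω' ∂P)) ^ n := by
    funext ω
    simp only [centered]
    ring
  rw [e]
  exact ((hm.add_const _).pow_const n).stronglyMeasurable

theorem condExp_centered_pow (h : IncrementsIndepPast P X hX) (hmom : ∀ t, HasMoments (X t) P)
    {s t : I} (hst : s ≤ t) (n : ℕ) :
    P[fun ω => centered P X t ω ^ n | past X hX s] =ᵐ[P]
      fun ω => binomConv (centered P X s ω ^ ·) (incrementMoments P X s t) n := by
  have hY := hasMoments_centered hmom
  have e : (fun ω => centered P X t ω ^ n) = fun ω =>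
      binomConv (centered P X s ω ^ ·) ((centered P X t ω - centered P X s ω) ^ ·) n := by
    funext ω
    rw [binomConv_pow, add_sub_cancel]
  rw [e]
  refine (condExp_binomConv (fun i => (stronglyMeasurable_centered hX s).pow i)
    (fun i => (hY s).pow i) (fun i => ((hY t).sub (hY s)).pow i) n).trans ?_
  filter_upwards [ae_all_iff.2 fun j => h.condExp_increment_pow hst j] with ω hω
  simp only [hω]
  rfl

theorem centralMoments_eq (h : IncrementsIndepPast P X hX) (hmom : ∀ t, HasMoments (X t) P)
    {s t : I} (hst : s ≤ t) :
    centralMoments P X t = binomConv (centralMoments P X s) (incrementMoments P X s t) := by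
  funext n
  rw [centralMoments, ← integral_condExp ((past X hX).le s),
    integral_congr_ae (h.condExp_centered_pow hmom hst n)]
  simp only [binomConv]
  rw [integral_finsetSum _ fun p _ =>
    (((hasMoments_centered hmom s).pow p.1).integrable.mul_const _).const_mul _]
  simp only [integral_const_mul, integral_mul_const, centralMoments]

theorem incrementMoments_two (h : IncrementsIndepPast P X hX) (hmom : ∀ t, HasMoments (X t) P)
    {s t : I} (hst : s ≤ t) :
    incrementMoments P X s t 2 = centralMoments P X t 2 - centralMoments P X s 2 := by
  rw [h.centralMoments_eq hmom hst,
    binomConv_eq_of_one (centralMoments_zero s) (incrementMoments_zero s t) one_le_two,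
    Finset.sum_eq_single 1 (fun j hj h1 => absurd (Finset.mem_Ico.1 hj) (by omega)) (by simp),
    centralMoments_one hmom]
  ring

theorem integral_sub_sq (h : IncrementsIndepPast P X hX) (hmom : ∀ t, HasMoments (X t) P)
    (s t : I) : ∫ ω, (centered P X s ω - centered P X t ω) ^ 2 ∂P =
      |centralMoments P X s 2 - centralMoments P X t 2| := by
  have key {s t : I} (hst : s ≤ t) : ∫ ω, (centered P X t ω - centered P X s ω) ^ 2 ∂P =
      |centralMoments P X t 2 - centralMoments P X s 2| := by
    rw [← h.incrementMoments_two hmom hst, incrementMoments,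
      abs_of_nonneg (integral_nonneg fun ω => sq_nonneg _)]
  rcases le_total t s with hst | hst
  · exact key hst
  · rw [abs_sub_comm, ← key hst]
    exact integral_congr_ae (.of_forall fun ω => sub_sq_comm _ _)

/-- Even central moments increase, since `(y + d) ^ 2k ≥ y ^ 2k + 2k y ^ (2k - 1) d` and the
centered increment has conditional mean `0`. -/
theorem centralMoments_even_mono (h : IncrementsIndepPast P X hX)
    (hmom : ∀ t, HasMoments (X t) P) {s t : I} (hst : s ≤ t) (k : ℕ) :
    centralMoments P X s (2 * k) ≤ centralMoments P X t (2 * k) := by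
  have hY := hasMoments_centered hmom
  have hD := (hY t).sub (hY s)
  have hzero : ∫ ω, centered P X s ω ^ (2 * k - 1) * (centered P X t ω - centered P X s ω) ∂P
      = 0 := by
    rw [← integral_condExp ((past X hX).le s), integral_congr_ae (g := fun _ => (0 : ℝ)) ?_]
    · simp
    · have h1 := h.condExp_increment_pow hst 1
      simp only [pow_one] at h1
      filter_upwards [condExp_mul_of_stronglyMeasurable_left
        ((stronglyMeasurable_centered (P := P) hX s).pow (2 * k - 1))
        (((hY s).pow (2 * k - 1)).mul hD).integrable hD.integrable, h1] with ω h2 h3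
      refine h2.trans ?_
      rw [Pi.mul_apply, h3, incrementMoments_one hmom, mul_zero]
  have htangent (y z : ℝ) : y ^ (2 * k) + (2 * k : ℕ) * (y ^ (2 * k - 1) * (z - y)) ≤
      z ^ (2 * k) := by
    have hconv : ConvexOn ℝ Set.univ fun x : ℝ => x ^ (2 * k) := (even_two_mul k).convexOn_pow
    have hder := hasDerivAt_pow (2 * k) y
    rcases lt_trichotomy y z with hyz | rfl | hyz
    · have h1 := hconv.le_slope_of_hasDerivAt (Set.mem_univ y) (Set.mem_univ z) hyz hder
      rw [slope_def_field, le_div_iff₀ (sub_pos.2 hyz)] at h1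
      linarith
    · simp
    · have h1 := hconv.slope_le_of_hasDerivAt (Set.mem_univ z) (Set.mem_univ y) hyz hder
      rw [slope_def_field, div_le_iff₀ (sub_pos.2 hyz)] at h1
      linarith
  calc centralMoments P X s (2 * k)
      = ∫ ω, (centered P X s ω ^ (2 * k) + (2 * k : ℕ) * (centered P X s ω ^ (2 * k - 1) *
          (centered P X t ω - centered P X s ω))) ∂P := by
        rw [integral_add ((hY s).pow _).integrable
          ((((hY s).pow _).mul hD).integrable.const_mul _), integral_const_mul, hzero, mul_zero,
          add_zero, centralMoments]
    _ ≤ centralMoments P X t (2 * k) :=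
        integral_mono (((hY s).pow _).add ((HasMoments.const _).mul
          (((hY s).pow _).mul hD))).integrable ((hY t).pow _).integrable
          fun ω => htangent _ _

theorem tendsto_centralMoments (h : IncrementsIndepPast P X hX)
    (hmom : ∀ t, HasMoments (X t) P) {l : Filter I} {T : I} (hT : ∀ᶠ s in l, s ≤ T)
    {Z : Ω → ℝ} (hZ : HasMoments Z P)
    (h2 : Tendsto (fun s => ∫ ω, (centered P X s ω - Z ω) ^ 2 ∂P) l (𝓝 0)) (n : ℕ) :
    Tendsto (fun s => centralMoments P X s n) l (𝓝 (∫ ω, Z ω ^ n ∂P)) :=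
  tendsto_integral_pow (hasMoments_centered hmom) hZ
    (fun k => ⟨centralMoments P X T (2 * k), hT.mono fun _ hs =>
      h.centralMoments_even_mono hmom hs k⟩) h2 n

/-- All central moments are continuous as soon as the variance is. -/
theorem continuous_centralMoments [TopologicalSpace I] [OrderClosedTopology I]
    (h : IncrementsIndepPast P X hX) (hmom : ∀ t, HasMoments (X t) P) (hvar : Continuous fun t => centralMoments P X t 2) (n : ℕ) :
    Continuous fun t => centralMoments P X t n := by
  refine continuous_iff_continuousAt.2 fun t => ?_
  obtain ⟨T, hT⟩ : ∃ T, ∀ᶠ s in 𝓝 t, s ≤ T := by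
    by_cases ht : ∃ T, t < T
    · obtain ⟨T, hT⟩ := ht
      exact ⟨T, (eventually_lt_nhds hT).mono fun _ => le_of_lt⟩
    · exact ⟨t, .of_forall fun s => not_lt.1 fun hs => ht ⟨s, hs⟩⟩
  refine h.tendsto_centralMoments hmom hT (hasMoments_centered hmom t) ?_ n
  simp only [h.integral_sub_sq hmom]
  simpa using ((hvar.tendsto t).sub_const (centralMoments P X t 2)).abs

theorem tendsto_centralMoments_atBot (h : IncrementsIndepPast P X hX)
    (hmom : ∀ t, HasMoments (X t) P)
    (hvar : Tendsto (fun t => centralMoments P X t 2) atBot (𝓝 0)) (n : ℕ) :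
    Tendsto (fun t => centralMoments P X t n) atBot (𝓝 (0 ^ n)) := by
  rcases isEmpty_or_nonempty I with hI | ⟨⟨T⟩⟩
  · simp [filter_eq_bot_of_isEmpty]
  · simpa using h.tendsto_centralMoments hmom (eventually_le_atBot T) (HasMoments.const 0)
      (by simpa [centralMoments] using hvar) n

/-- For independent increments the linear martingale is `a (X_t - E X_t)`, with a coefficient
`a ≠ 0` that does not depend on `t` as long as `X_t` is not constant. -/
theorem exists_sq_eq_mul_variance [TopologicalSpace I] (h : IncrementsIndepPast P X hX)
    (hmom : ∀ t, HasMoments (X t) P) {M : ℕ → I → Polynomial ℝ}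
    (hM : IsPolynomialMartingaleFamily P X hX M) :
    ∃ c : ℝ, c ≠ 0 ∧ ∀ t, ∫ ω, (M 1 t).eval (X t ω) ^ 2 ∂P = c * centralMoments P X t 2 := by
  set a : I → ℝ := fun t => (M 1 t).coeff 1
  have ha (t : I) : a t ≠ 0 := by
    have h1 : M 1 t ≠ 0 := fun h0 => by simpa [h0] using hM.natDegree 1 t
    have := Polynomial.leadingCoeff_ne_zero.2 h1
    rwa [Polynomial.leadingCoeff, hM.natDegree] at this
  have heval0 (t : I) (x : ℝ) : (M 1 t).eval x = (M 1 t).coeff 0 + a t * x := by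
    rw [Polynomial.eval_eq_sum_range, hM.natDegree, Finset.sum_range_succ, Finset.sum_range_one]
    simp [a]
  have heval (t : I) (ω : Ω) : (M 1 t).eval (X t ω) = a t * centered P X t ω := by
    have h0 := hM.integral_eq_zero hmom le_rfl t
    simp only [heval0] at h0 ⊢
    rw [integral_add (integrable_const _) ((hmom t).integrable.const_mul _), integral_const_mul]
      at h0
    simp only [integral_const, probReal_univ, one_smul] at h0
    rw [centered]
    linear_combination h0
  have hsq (t : I) : ∫ ω, (M 1 t).eval (X t ω) ^ 2 ∂P = a t ^ 2 * centralMoments P X t 2 := by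
    simp only [heval, mul_pow, integral_const_mul, centralMoments]
  -- Conditioning `a t * Y_t` on the past gives both `a t * Y_s` and `a s * Y_s`.
  have hcoef {s t : I} (hst : s ≤ t) (hs : centralMoments P X s 2 ≠ 0) : a s = a t := by
    have h1 := h.condExp_centered_pow hmom hst 1
    have h2 := (hM.martingale 1).2 s t hst
    simp only [heval] at h2
    have h3 : ∀ᵐ ω ∂P, a t * centered P X s ω = a s * centered P X s ω := by
      filter_upwards [h1, h2, condExp_smul (a t) (centered P X t) (past X hX s) (μ := P)]
        with ω e1 e2 e3
      have e4 : binomConv (centered P X s ω ^ ·) (incrementMoments P X s t) 1 =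
          centered P X s ω := by
        rw [binomConv_eq_of_one (pow_zero _) (incrementMoments_zero s t) le_rfl]
        simp [incrementMoments_one hmom]
      simp only [pow_one, e4] at e1
      rw [← e2, ← e1]
      exact e3.symm
    by_contra hne
    refine hs ?_
    rw [centralMoments, integral_congr_ae (g := fun _ => (0 : ℝ)) ?_, integral_zero]
    filter_upwards [h3] with ω e
    have : (a t - a s) * centered P X s ω = 0 := by linear_combination e
    rcases mul_eq_zero.1 this with h0 | h0
    · exact absurd (sub_eq_zero.1 h0).symm hne
    · simp [h0]
  by_cases hex : ∃ t₀, centralMoments P X t₀ 2 ≠ 0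
  · obtain ⟨t₀, ht₀⟩ := hex
    refine ⟨a t₀ ^ 2, pow_ne_zero 2 (ha t₀), fun t => ?_⟩
    rw [hsq]
    by_cases ht : centralMoments P X t 2 = 0
    · simp [ht]
    · rcases le_total t t₀ with h1 | h1
      · rw [hcoef h1 ht]
      · rw [hcoef h1 ht₀]
  · push Not at hex
    exact ⟨1, one_ne_zero, fun t => by rw [hsq, hex, mul_zero, mul_zero]⟩

end IncrementsIndepPast

end Centered

/-! ### The Appell martingales -/

/-- The Appell polynomial `∑_{i+j=n} C(n,i) hᵢ (x - μ)^j`, where `egf h` is the inverse of the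
exponential generating function of the central moments `y`. -/
noncomputable def appell (μ : ℝ) (y : ℕ → ℝ) (n : ℕ) : Polynomial ℝ :=
  ∑ p ∈ Finset.HasAntidiagonal.antidiagonal n, Polynomial.C ((n.choose p.1 : ℝ) * egfInv y p.1) *
    (Polynomial.X - Polynomial.C μ) ^ p.2

theorem eval_appell (μ : ℝ) (y : ℕ → ℝ) (n : ℕ) (x : ℝ) :
    (appell μ y n).eval x = binomConv (egfInv y) ((x - μ) ^ ·) n := by
  simp [appell, binomConv, Polynomial.eval_finsetSum, mul_assoc]

theorem appell_zero (μ : ℝ) {y : ℕ → ℝ} (hy : y 0 = 1) : appell μ y 0 = 1 := by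
  simp [appell, egfInv_zero hy]

theorem natDegree_appell (μ : ℝ) {y : ℕ → ℝ} (hy : y 0 = 1) (n : ℕ) :
    (appell μ y n).natDegree = n := by
  rcases Nat.eq_zero_or_pos n with rfl | hn
  · simp [appell_zero μ hy]
  rw [appell, Finset.Nat.sum_antidiagonal_eq_sum_range_succ_mk, Finset.range_eq_Ico,
    Finset.sum_eq_sum_Ico_succ_bot (by omega), Polynomial.natDegree_add_eq_left_of_natDegree_lt]
  · simp [egfInv_zero hy]
  · have hlow : (∑ k ∈ Finset.Ico (0 + 1) n.succ, Polynomial.C ((n.choose k : ℝ) * egfInv y k) *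
        (Polynomial.X - Polynomial.C μ) ^ (n - k)).natDegree ≤ n - 1 := by
      refine Polynomial.natDegree_sum_le_of_forall_le _ _ fun k hk => ?_
      have := Finset.mem_Ico.1 hk
      refine (Polynomial.natDegree_C_mul_le _ _).trans ?_
      simp
      omega
    refine hlow.trans_lt ?_
    simp [egfInv_zero hy]
    omega

/-- The second moment of the `n`-th Appell polynomial, in terms of the central moments `y`. -/
noncomputable def appellSq (y : ℕ → ℝ) (n : ℕ) : ℝ :=
  ∑ p ∈ Finset.HasAntidiagonal.antidiagonal n, ∑ q ∈ Finset.HasAntidiagonal.antidiagonal n,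
    (n.choose p.1 : ℝ) * egfInv y p.1 * ((n.choose q.1 : ℝ) * egfInv y q.1) * y (p.2 + q.2)

theorem tendsto_appellSq {ι : Type*} {l : Filter ι} {y : ι → ℕ → ℝ} {y₀ : ℕ → ℝ}
    (hy : ∀ t, y t 0 = 1) (hy₀ : y₀ 0 = 1) (h : ∀ n, Tendsto (fun t => y t n) l (𝓝 (y₀ n)))
    (n : ℕ) : Tendsto (fun t => appellSq (y t) n) l (𝓝 (appellSq y₀ n)) :=
  tendsto_finsetSum _ fun p _ => tendsto_finsetSum _ fun q _ =>
    (((tendsto_egfInv hy hy₀ h p.1).const_mul _).mul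
      ((tendsto_egfInv hy hy₀ h q.1).const_mul _)).mul (h _)

theorem appellSq_zero_pow {n : ℕ} (hn : 1 ≤ n) : appellSq (0 ^ ·) n = 0 := by
  have hinv : egfInv ((0 : ℝ) ^ ·) = ((0 : ℝ) ^ ·) := egf_injective <| by
    rw [egf_egfInv, egf_zero_pow, inv_one]
  refine Finset.sum_eq_zero fun p hp => Finset.sum_eq_zero fun q _ => ?_
  have hp := Finset.HasAntidiagonal.mem_antidiagonal.1 hp
  rcases Nat.eq_zero_or_pos p.1 with h | h
  · have h0 : (0 : ℝ) ^ (p.2 + q.2) = 0 := zero_pow (by omega)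
    simp only [h0, mul_zero]
  · rw [hinv]
    simp [zero_pow h.ne']

section Appell

variable {I Ω : Type*} [MeasurableSpace Ω] {P : Measure Ω} {X : I → Ω → ℝ}

/-- The Appell polynomials of `X`, in `X_t - E X_t` and with respect to the central moments. -/
noncomputable def appellFamily (P : Measure Ω) (X : I → Ω → ℝ) (n : ℕ) (t : I) : Polynomial ℝ :=
  appell (∫ ω, X t ω ∂P) (centralMoments P X t) n

theorem eval_appellFamily (n : ℕ) (t : I) (ω : Ω) :
    (appellFamily P X n t).eval (X t ω) =
      binomConv (egfInv (centralMoments P X t)) (centered P X t ω ^ ·) n :=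
  eval_appell _ _ _ _

variable [IsProbabilityMeasure P]

theorem integral_appellFamily_sq (hmom : ∀ t, HasMoments (X t) P) (n : ℕ) (t : I) :
    ∫ ω, (appellFamily P X n t).eval (X t ω) ^ 2 ∂P = appellSq (centralMoments P X t) n := by
  have e (ω : Ω) : (appellFamily P X n t).eval (X t ω) ^ 2 =
      ∑ p ∈ Finset.HasAntidiagonal.antidiagonal n, ∑ q ∈ Finset.HasAntidiagonal.antidiagonal n,
        (n.choose p.1 : ℝ) * egfInv (centralMoments P X t) p.1 *
          ((n.choose q.1 : ℝ) * egfInv (centralMoments P X t) q.1) *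
          centered P X t ω ^ (p.2 + q.2) := by
    rw [eval_appellFamily, binomConv, sq, Finset.sum_mul_sum]
    refine Finset.sum_congr rfl fun p _ => Finset.sum_congr rfl fun q _ => ?_
    ring
  have hint (k : ℕ) (c : ℝ) : Integrable (fun ω => c * centered P X t ω ^ k) P :=
    ((hasMoments_centered hmom t).pow k).integrable.const_mul c
  simp only [e]
  rw [integral_finsetSum _ fun p _ => integrable_finsetSum _ fun q _ => hint _ _]
  refine Finset.sum_congr rfl fun p _ => ?_
  rw [integral_finsetSum _ fun q _ => hint _ _]
  simp only [integral_const_mul, centralMoments]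

theorem satisfiesRecurrence_appellFamily (hmom : ∀ t, HasMoments (X t) P) :
    SatisfiesRecurrence P X (appellFamily P X) fun n t => ∫ ω, X t ω ^ n ∂P := by
  refine fun n hn t => .of_forall fun ω => ?_
  have hmoments : (fun n => ∫ ω, X t ω ^ n ∂P) =
      binomConv ((∫ ω, X t ω ∂P) ^ ·) (centralMoments P X t) :=
    funext (integral_pow_eq_binomConv hmom t)
  have hconv : binomConv (fun n => ∫ ω, X t ω ^ n ∂P)
      (fun n => (appellFamily P X n t).eval (X t ω)) = (X t ω ^ ·) := by
    refine egf_injective ?_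
    simp only [eval_appellFamily]
    have hexp := egf_pow_mul (∫ ω, X t ω ∂P) (centered P X t ω)
    rw [centered, add_sub_cancel] at hexp
    rw [egf_binomConv, hmoments, egf_binomConv,
      show (fun n => binomConv (egfInv (centralMoments P X t)) (centered P X t ω ^ ·) n) =
        binomConv (egfInv (centralMoments P X t)) (centered P X t ω ^ ·) from rfl,
      egf_binomConv, egf_egfInv, ← hexp, centered]
    linear_combination (egf ((∫ ω, X t ω ∂P) ^ ·) * egf ((X t ω - ∫ ω, X t ω ∂P) ^ ·)) *
      egf_mul_inv (centralMoments_zero (P := P) (X := X) t)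
  have h := congrFun hconv n
  rw [binomConv_eq_of_one (by simp)
    (by simp [appellFamily, appell_zero _ (centralMoments_zero t)]) hn] at h
  linear_combination h

variable [LinearOrder I] {hX : ∀ t, Measurable (X t)}

/-- With independent increments, conditioning multiplies the generating function of the powers of
`X_t - E X_t` by that of the moments of the increment, and so does passing from time `s` to time
`t` in the normalizing factor. -/
theorem IncrementsIndepPast.martingale_appellFamily (h : IncrementsIndepPast P X hX)
    (hmom : ∀ t, HasMoments (X t) P) (n : ℕ) :
    Martingale (fun t ω => (appellFamily P X n t).eval (X t ω)) (past X hX) P := by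
  refine ⟨fun t => (Polynomial.continuous _).comp_stronglyMeasurable
    (stronglyMeasurable_past X hX t), fun s t hst => ?_⟩
  simp only [eval_appellFamily]
  refine (condExp_binomConv (U := fun i _ => egfInv (centralMoments P X t) i)
    (fun _ => stronglyMeasurable_const) (fun _ => HasMoments.const _)
    (fun i => (hasMoments_centered hmom t).pow i) n).trans ?_
  filter_upwards [ae_all_iff.2 fun j => h.condExp_centered_pow hmom hst j] with ω hω
  refine congrFun (egf_injective ?_) n
  simp only [hω, egf_binomConv, egf_egfInv]
  have h1 := egf_mul_inv (centralMoments_zero (P := P) (X := X) t)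
  have h2 := egf_mul_inv (centralMoments_zero (P := P) (X := X) s)
  have h3 := congrArg egf (h.centralMoments_eq hmom hst)
  rw [egf_binomConv] at h3
  set G := egf (centralMoments P X s)
  set G' := egf (centralMoments P X t)
  set E := egf (centered P X s ω ^ ·)
  set C := egf (incrementMoments P X s t)
  linear_combination G⁻¹ * E * h1 - G'⁻¹ * E * C * h2 - G⁻¹ * G'⁻¹ * E * h3

theorem IncrementsIndepPast.exists_recurrence [TopologicalSpace I] [OrderClosedTopology I]
    (h : IncrementsIndepPast P X hX) (hMPR : IsMPR P X hX)
    (hmean : Continuous fun t => ∫ ω, X t ω ∂P) :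
    ∃ (M : ℕ → I → Polynomial ℝ) (g : ℕ → I → ℝ),
      IsPolynomialMartingaleFamily P X hX M ∧ (∀ k, 1 ≤ k → Continuous (g k)) ∧
        SatisfiesRecurrence P X M g := by
  have hmom := hMPR.hasMoments
  obtain ⟨N, hN⟩ := hMPR.exists_martingales
  obtain ⟨c, hc, hNc⟩ := h.exists_sq_eq_mul_variance hmom hN
  have hvar (t : I) : centralMoments P X t 2 = c⁻¹ * ∫ ω, (N 1 t).eval (X t ω) ^ 2 ∂P := by
    rw [hNc, inv_mul_cancel_left₀ hc]
  have hcont : ∀ n, Continuous fun t => centralMoments P X t n :=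
    h.continuous_centralMoments hmom (by
      simpa only [hvar] using (hN.continuous_sq 1 le_rfl).const_mul c⁻¹)
  have hbot : ∀ n, Tendsto (fun t => centralMoments P X t n) atBot (𝓝 (0 ^ n)) :=
    h.tendsto_centralMoments_atBot hmom (by
      simpa only [hvar, mul_zero] using (hN.tendsto_sq 1 le_rfl).const_mul c⁻¹)
  refine ⟨appellFamily P X, fun n t => ∫ ω, X t ω ^ n ∂P, ?_, fun k _ => ?_,
    satisfiesRecurrence_appellFamily hmom⟩
  · refine ⟨fun t => appell_zero _ (centralMoments_zero t),
      fun n t => natDegree_appell _ (centralMoments_zero t) n, h.martingale_appellFamily hmom,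
      fun n _ => ?_, fun n hn => ?_⟩
    · simp only [integral_appellFamily_sq hmom]
      exact continuous_iff_continuousAt.2 fun t => tendsto_appellSq centralMoments_zero
        (centralMoments_zero t) (fun k => (hcont k).tendsto t) n
    · simp only [integral_appellFamily_sq hmom]
      rw [← appellSq_zero_pow hn]
      exact tendsto_appellSq centralMoments_zero (pow_zero _) hbot n
  · simp only [integral_pow_eq_binomConv hmom, binomConv]
    exact continuous_finsetSum _ fun p _ =>
      continuous_const.mul ((hmean.pow _).mul (hcont _))

end Appell

end MPR

theorem proposition1 {I Ω : Type*} [LinearOrder I] [TopologicalSpace I] [OrderClosedTopology I]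
    [MeasurableSpace Ω] (P : Measure Ω) [IsProbabilityMeasure P]
    (X : I → Ω → ℝ) (hX : ∀ t, Measurable (X t)) (hMPR : MPR.IsMPR P X hX)
    (hmean : Continuous fun t => ∫ ω, X t ω ∂P) :
    (MPR.IncrementsIndepPast P X hX ↔
      ∃ (M : ℕ → I → Polynomial ℝ) (g : ℕ → I → ℝ),
        MPR.IsPolynomialMartingaleFamily P X hX M ∧
        (∀ k, 1 ≤ k → Continuous (g k)) ∧
        MPR.SatisfiesRecurrence P X M g) ∧
    (∀ (M : ℕ → I → Polynomial ℝ) (g : ℕ → I → ℝ),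
      MPR.IsPolynomialMartingaleFamily P X hX M →
      MPR.SatisfiesRecurrence P X M g →
      ∀ n, 1 ≤ n → ∀ t, g n t = ∫ ω, X t ω ^ n ∂P) :=
  ⟨⟨fun h => h.exists_recurrence hMPR hmean,
    fun ⟨_, _, hM, _, hg⟩ => hg.incrementsIndepPast hMPR hM⟩,
    fun _ _ hM hg _ hn t => hg.eq_integral_pow hM hMPR.hasMoments hn t⟩
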